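/- Let $N=\{1,\dots,n\}$, $n\ge 2$, be a set of voters and let $P=\{p_1,\dots,p_m\}$, $m\ge 1$, be a set of projects ordered by $p_1\triangleleft\dots\triangleleft p_m$; minima, maxima and intervals of projects refer to this order, and $\trianglelefteq$ is its reflexive version. Let $\mathcal D$ be the set of all single-peaked strict linear orders $\succ$ on $P$: if $\succ(1)$ denotes the top-ranked project, then $p\succ p'$ whenever $\succ(1)\triangleleft p\triangleleft p'$ or $p'\triangleleft p\triangleleft\succ(1)$. A deterministic rule is a map $f:\mathcal D^n\to P$, and a random rule is a map $\varphi:\mathcal D^n\to\Delta P$, where $\Delta P$ is the set of probability distributions on $P$; $\varphi_p(\mathcal P_N)$ is the probability of $p$ at the profile $\mathcal P_N=(\succ_1,\dots,\succ_n)$. The voters are partitioned into groups $N_1,\dots,N_g$, and $G=\{1,\dots,g\}$. Each group $q\in G$ has an integer $\kappa_q\in[1,m]$, a number $\eta_q\in[0,1]$, and a function $\psi_q:\mathcal D^{N_q}\to 2^P$ such that, for every $\mathcal P_{N_q}\in\mathcal D^{N_q}$, the set $\psi_q(\mathcal P_{N_q})$ is an interval of exactly $\kappa_q$ projects and contains a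 project $p$ with $\succ_i(1)\trianglelefteq p\trianglelefteq\succ_j(1)$ for some $i,j\in N_q$. A random rule $\varphi$ is - unanimous if $\varphi_p(\mathcal P_N)=1$ whenever $\succ_i(1)=p$ for all $i\in N$; - strategy-proof if, for every profile $\mathcal P_N$, voter $i$, preference $\succ_i'\in\mathcal D$ and project $p$, the set $U=\{p\}\cup\{p':p'\succ_i p\}$ has at least as much probability under $\varphi(\mathcal P_N)$ as under $\varphi(\succ_i',\succ_{-i})$; - group-wise anonymous if $\varphi(\succ_1,\dots,\succ_n)=\varphi(\succ_{\pi(1)},\dots,\succ_{\pi(n)})$ for every profile and every permutation $\pi$ of $N$ that maps each $N_q$ into itself; - $(\kappa_G,\psi_G,\eta_G)$-strong-GEG (strong group entitlement guarantee) if, for every profile $\mathcal P_N$ and every $q\in G$, there is $p\in\psi_q(\mathcal P_{N_q})$ with $\varphi_p(\mathcal P_N)\ge\eta_q$, where $\mathcal P_{N_q}$ is the restriction of $\mathcal P_N$ to $N_q$. Let $\Gamma=\prod_{q\in G}\{0,\dots,|N_q|\}$, and write $\gamma\gg\gamma'$ if $\gamma_q\ge\gamma'_q$ for all $q$; let $\underline\gamma=(0,\dots,0)$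 and $\overline\gamma=(|N_1|,\dots,|N_g|)$. For $1\le t\le|N_q|$ let $\tau_t(\mathcal P_{N_q})$ be the $t$-th project when the top-ranked projects of the voters in $N_q$ are listed in increasing order with repetition, and let $\tau_0(\mathcal P_{N_q})=p_1$. A deterministic rule $f$ is a group min-max rule with parameters $(\beta_\gamma)_{\gamma\in\Gamma}$, $\beta_\gamma\in P$, if $\beta_{\underline\gamma}=p_m$, $\beta_{\overline\gamma}=p_1$, $\beta_\gamma\trianglelefteq\beta_{\gamma'}$ whenever $\gamma\gg\gamma'$, and $$f(\mathcal P_N)=\min_{\gamma\in\Gamma}\max\{\tau_{\gamma_1}(\mathcal P_{N_1}),\dots,\tau_{\gamma_g}(\mathcal P_{N_g}),\beta_\gamma\}\quad\text{for all }\mathcal P_N .$$ A random group min-max rule is a finite convex combination $\varphi=\sum_{w\in W}\lambda_w\varphi_w$ ($0\le\lambda_w\le 1$, $\sum_w\lambda_w=1$) of deterministic rules in which every $\varphi_w$ with $\lambda_w>0$ is a group min-max rule; its parameters are denoted by $\beta^{\varphi_w}_\gamma$. For integers $z_0,\dots,z_{\kappa_q}$, the projects $p_x,p_{x+1},\dots,p_{x+\kappa_q-1}$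 are feasible at $(z_0,\dots,z_{\kappa_q};\psi_q)$ if there is $\mathcal P_{N_q}\in\mathcal D^{N_q}$ such that $p_x=\min\psi_q(\mathcal P_{N_q})$, exactly $z_0$ voters $i\in N_q$ have $\succ_i(1)\triangleleft p_x$, and, for every $1\le j\le\kappa_q$, exactly $z_j$ voters $i\in N_q$ have $\succ_i(1)\trianglelefteq p_{x+j-1}$. **Theorem.** A random rule $\varphi:\mathcal D^n\to\Delta P$ is unanimous, strategy-proof, group-wise anonymous and $(\kappa_G,\psi_G,\eta_G)$-strong-GEG if and only if it can be written as a random group min-max rule $\varphi=\sum_{w\in W}\lambda_w\varphi_w$ such that, for all $q\in G$, all $\gamma^0,\dots,\gamma^{\kappa_q}\in\Gamma$ with $\gamma^{\kappa_q}\gg\dots\gg\gamma^1\gg\gamma^0$, and all $p_x\in P$ such that $p_x,\dots,p_{x+\kappa_q-1}$ are feasible at $(\gamma^0_q,\dots,\gamma^{\kappa_q}_q;\psi_q)$, there is $t\in\{0,\dots,\kappa_q-1\}$ with $$\sum_{\{w\,:\,p_{x+t}\trianglelefteq\beta^{\varphi_w}_{\gamma^t},\ \beta^{\varphi_w}_{\gamma^{t+1}}\trianglelefteq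 p_{x+t}\}}\lambda_w\ \ge\ \eta_q .$$ -/

import Mathlib

open scoped Classical

namespace GroupFair

/-- A strictly ordinal single-peaked preference on the projects `p_1 ◁ … ◁ p_m`, the projects being
the elements of `Fin m` in their natural order (`p_k` is the element of value `k - 1`).
`rel a b` says that `a` is at least as good as `b`. -/
structure Pref (m : ℕ) where
  rel : Fin m → Fin m → Prop
  refl : ∀ a, rel a a
  total : ∀ a b, rel a b ∨ rel b a
  antisymm : ∀ a b, rel a b → rel b a → a = b
  trans : ∀ a b c, rel a b → rel b c → rel a c
  singlePeaked : ∀ a, (∀ b, rel a b) →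
    ∀ p p', (a < p ∧ p < p') ∨ (p' < p ∧ p < a) → rel p p'

theorem Pref.exists_top {m : ℕ} [NeZero m] (r : Pref m) : ∃ a, ∀ b, r.rel a b := by
  have h : ∀ s : Finset (Fin m), s.Nonempty → ∃ a ∈ s, ∀ b ∈ s, r.rel a b := by
    intro s hs
    induction hs using Finset.Nonempty.cons_induction with
    | singleton a => exact ⟨a, by simp, by simpa using r.refl a⟩
    | cons a s ha hs ih =>
      obtain ⟨c, hc, hcs⟩ := ih
      rcases r.total a c with hac | hca
      · refine ⟨a, by simp, fun b hb => ?_⟩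
        rcases Finset.mem_cons.1 hb with rfl | hb
        · exact r.refl _
        · exact r.trans _ _ _ hac (hcs b hb)
      · refine ⟨c, by simp [hc], fun b hb => ?_⟩
        rcases Finset.mem_cons.1 hb with rfl | hb
        · exact hca
        · exact hcs b hb
  obtain ⟨a, -, ha⟩ := h Finset.univ Finset.univ_nonempty
  exact ⟨a, fun b => ha b (Finset.mem_univ b)⟩

/-- The top-ranked project of a preference. -/
noncomputable def Pref.top {m : ℕ} [NeZero m] (r : Pref m) : Fin m :=
  Classical.choose r.exists_top

theorem Pref.top_spec {m : ℕ} [NeZero m] (r : Pref m) (b : Fin m) : r.rel r.top b :=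
  Classical.choose_spec r.exists_top b

/-- The upper contour set of `p`: the projects at least as good as `p`. -/
noncomputable def Pref.upper {m : ℕ} (r : Pref m) (p : Fin m) : Finset (Fin m) :=
  Finset.univ.filter fun a => r.rel a p

/-- Preference profiles of all voters. -/
abbrev Profile (n m : ℕ) := Fin n → Pref m

/-- Preference profiles of a set `S` of voters. -/
abbrev SubProfile {n : ℕ} (S : Finset (Fin n)) (m : ℕ) := {i // i ∈ S} → Pref m

/-- The restriction of a profile to a set of voters. -/
def Profile.restrict {n m : ℕ} (P : Profile n m) (S : Finset (Fin n)) : SubProfile S m :=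
  fun i => P i.1

/-- Deterministic social choice rules. -/
abbrev DSCR (n m : ℕ) := Profile n m → Fin m

/-- Random social choice rules. -/
abbrev RSCR (n m : ℕ) := Profile n m → stdSimplex ℝ (Fin m)

/-- `δ` stochastically dominates `δ'` with respect to the preference `r`. -/
def StochDom {m : ℕ} (r : Pref m) (δ δ' : stdSimplex ℝ (Fin m)) : Prop :=
  ∀ p, ∑ a ∈ r.upper p, δ'.1 a ≤ ∑ a ∈ r.upper p, δ.1 a

def Unanimous {n m : ℕ} [NeZero m] (φ : RSCR n m) : Prop :=
  ∀ (p : Fin m) (P : Profile n m), (∀ i, (P i).top = p) → (φ P).1 p = 1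

def StrategyProof {n m : ℕ} (φ : RSCR n m) : Prop :=
  ∀ (i : Fin n) (P : Profile n m) (r' : Pref m),
    StochDom (P i) (φ P) (φ (Function.update P i r'))

/-- `N_1, …, N_g` are pairwise disjoint and cover the set of voters. -/
def IsPartition {n g : ℕ} (N : Fin g → Finset (Fin n)) : Prop :=
  (∀ p q, p ≠ q → Disjoint (N p) (N q)) ∧ ∀ i, ∃ q, i ∈ N q

/-- A permutation of the voters is group preserving if it maps each group into itself. -/
def GroupPreserving {n g : ℕ} (N : Fin g → Finset (Fin n)) (π : Equiv.Perm (Fin n)) : Prop :=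
  ∀ q, ∀ i ∈ N q, π i ∈ N q

def GroupwiseAnonymous {n m g : ℕ} (N : Fin g → Finset (Fin n)) (φ : RSCR n m) : Prop :=
  ∀ π : Equiv.Perm (Fin n), GroupPreserving N π →
    ∀ P : Profile n m, φ P = φ (fun i => P (π i))

/-- A representative function for a set `S` of voters. -/
abbrev RepFun {n : ℕ} (S : Finset (Fin n)) (m : ℕ) := SubProfile S m → Finset (Fin m)

/-- Some representative always lies between two top-ranked projects of voters in `S`. -/
def TopRanged {n m : ℕ} [NeZero m] {S : Finset (Fin n)} (ψ : RepFun S m) : Prop :=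
  ∀ P : SubProfile S m, ∃ p ∈ ψ P, ∃ i j : {i // i ∈ S}, (P i).top ≤ p ∧ p ≤ (P j).top

/-- Every representative function is top-ranged and selects an interval of `κ q` projects. -/
def Compliant {n m g : ℕ} [NeZero m] (N : Fin g → Finset (Fin n)) (κ : Fin g → ℕ)
    (ψ : ∀ q, RepFun (N q) m) : Prop :=
  ∀ q, TopRanged (ψ q) ∧
    ∀ P : SubProfile (N q) m, (ψ q P).card = κ q ∧ (ψ q P : Set (Fin m)).OrdConnected

/-- Strong group entitlement guarantee: at every profile, every group `q` has a representative that
receives probability at least `η q`. -/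
def StrongGEG {n m g : ℕ} (N : Fin g → Finset (Fin n)) (ψ : ∀ q, RepFun (N q) m)
    (η : Fin g → ℝ) (φ : RSCR n m) : Prop :=
  ∀ (P : Profile n m) (q : Fin g), ∃ p ∈ ψ q (P.restrict (N q)), η q ≤ (φ P).1 p

/-- The vectors `(γ_1, …, γ_g)` with `0 ≤ γ_q ≤ |N_q|`. Domination `γ ≫ γ'` is the componentwise
order `γ' ≤ γ`. -/
abbrev Gam {n g : ℕ} (N : Fin g → Finset (Fin n)) := ∀ q : Fin g, Fin ((N q).card + 1)

/-- The number of voters of `S` whose top-ranked project is `p` or lies before `p`. -/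
noncomputable def countLE {n m : ℕ} [NeZero m] {S : Finset (Fin n)} (P : SubProfile S m)
    (p : Fin m) : ℕ :=
  (Finset.univ.filter fun i => (P i).top ≤ p).card

/-- The number of voters of `S` whose top-ranked project lies strictly before `p`. -/
noncomputable def countLT {n m : ℕ} [NeZero m] {S : Finset (Fin n)} (P : SubProfile S m)
    (p : Fin m) : ℕ :=
  (Finset.univ.filter fun i => (P i).top < p).card

theorem tau_aux {n m : ℕ} [NeZero m] {S : Finset (Fin n)} (P : SubProfile S m)
    (t : Fin (S.card + 1)) :
    (Finset.univ.filter fun p : Fin m => (t : ℕ) ≤ countLE P p).Nonempty := by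
  refine ⟨⊤, ?_⟩
  have h : countLE P ⊤ = S.card := by simp [countLE]
  simpa [h] using Nat.lt_succ_iff.1 t.2

/-- The project at position `t` when the top-ranked projects of the voters in `S` are listed in
increasing order with repetition, that is, the smallest `p` such that at least `t` of them are at or
before `p`. For `t = 0` this is `p_1`. -/
noncomputable def tau {n m : ℕ} [NeZero m] {S : Finset (Fin n)} (P : SubProfile S m)
    (t : Fin (S.card + 1)) : Fin m :=
  (Finset.univ.filter fun p : Fin m => (t : ℕ) ≤ countLE P p).min' (tau_aux P t)

/-- `f` is the group min-max rule with parameters `β`. Here `⊤` is `p_m` and `⊥` is `p_1`. -/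
def IsGroupMinMax {n m g : ℕ} [NeZero m] (N : Fin g → Finset (Fin n)) (β : Gam N → Fin m)
    (f : DSCR n m) : Prop :=
  β (fun _ => 0) = ⊤ ∧ β (fun q => Fin.last (N q).card) = ⊥ ∧
  (∀ γ γ' : Gam N, γ' ≤ γ → β γ ≤ β γ') ∧
  ∀ P : Profile n m, f P = Finset.univ.inf' Finset.univ_nonempty fun γ : Gam N =>
    max (Finset.univ.sup fun q => tau (P.restrict (N q)) (γ q)) (β γ)

/-- `φ = ∑ w, lam w • f w` is a convex combination of deterministic rules in which every `f w` of
positive weight is the group min-max rule with parameters `β w`: the rule `φ` is a random group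
min-max rule, with this decomposition. -/
def IsGroupMinMaxMixture {n m g r : ℕ} [NeZero m] (N : Fin g → Finset (Fin n)) (φ : RSCR n m)
    (lam : Fin r → ℝ) (f : Fin r → DSCR n m) (β : Fin r → Gam N → Fin m) : Prop :=
  (∀ w, 0 ≤ lam w ∧ lam w ≤ 1) ∧ ∑ w, lam w = 1 ∧
  (∀ w, 0 < lam w → IsGroupMinMax N (β w) (f w)) ∧
  ∀ (P : Profile n m) (p : Fin m), (φ P).1 p = ∑ w with f w P = p, lam w

/-- The projects `p 0, …, p (k - 1)` are feasible at `(z 0, …, z k)` for `ψ`: at some profile, the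
first of them is the smallest representative, exactly `z 0` voters have their top strictly before it,
and, for each of these projects, exactly `z (j + 1)` voters have their top at or before `p j`. -/
def Feasible {n m k : ℕ} [NeZero m] {S : Finset (Fin n)} (ψ : RepFun S m) (p : Fin k → Fin m)
    (z : Fin (k + 1) → ℕ) : Prop :=
  ∃ P : SubProfile S m,
    (∀ j : Fin k, (j : ℕ) = 0 → IsLeast (ψ P : Set (Fin m)) (p j) ∧ countLT P (p j) = z 0) ∧
    ∀ j : Fin k, countLE P (p j) = z j.succ

/-- The extra condition on a random group min-max rule with weights `lam` and parameters `β`. The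
chain is `γ 0, …, γ (κ q)`, and `p t` is the project `p_{x+t}` for `0 ≤ t ≤ κ q - 1`. -/
def StrongCondition {n m g r : ℕ} [NeZero m] (N : Fin g → Finset (Fin n)) (κ : Fin g → ℕ)
    (ψ : ∀ q, RepFun (N q) m) (η : Fin g → ℝ) (lam : Fin r → ℝ) (β : Fin r → Gam N → Fin m) :
    Prop :=
  ∀ (q : Fin g) (γ : Fin (κ q + 1) → Gam N), Monotone γ →
    ∀ (x : Fin m) (p : Fin (κ q) → Fin m), (∀ t, (p t : ℕ) = x + t) →
      Feasible (ψ q) p (fun j => (γ j q : ℕ)) →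
      ∃ t : Fin (κ q),
        η q ≤ ∑ w with p t ≤ β w (γ t.castSucc) ∧ β w (γ t.succ) ≤ p t, lam w

end GroupFair

open GroupFair

namespace GroupFair

/-! Under unanimity and strategy-proofness, the probability of an initial segment depends only on
which voters have their tops in it. The obstacle is a voter with top inside who ranks some outside
project above an inside one. Such a defect can be removed by exchanging two adjacent projects on
opposite sides of the top. `prob_eq_of_exchangePair` shows that such an exchange is harmless, by
deforming the other voters until unanimity applies; `mass_update_eq_of_isRay` sorts a preference by
these exchanges. Group-wise anonymity then leaves only the group counts (`mass_Iic_le_of_countLE`),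
so the rule is encoded by `B γ p`, the probability of `Iic p` at counts `γ`, which is monotone in
both arguments.

Cutting `B` at a level `u ∈ (0, 1]` yields parameters: `β γ` is the least `p` with `u ≤ B γ p`. A
group min-max rule satisfies `f P ≤ p` iff `β (counts N P p) ≤ p` (`IsGroupMinMax.le_iff`), so
weighting the levels by the gaps between values of `B` (`exists_layers`) recovers all distribution
functions of the rule.

Applied to `p` and its predecessor, the same criterion gives `IsGroupMinMax.eq_iff`. Hence the sum
in the extra condition is the probability of `p t` at a profile with counts `γ t.castSucc` before it
and `γ t.succ` up to it. Every profile produces a feasible chain, and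
`IsPartition.exists_profile_of_chain` realises every feasible chain, up to harmless exceptions at
`⊥` and `⊤`; so the condition and the guarantee say the same thing, for any decomposition. -/

/-! ### Single-peaked preferences -/

/-- `V` is an upper set of the preference `r`. -/
def Pref.IsUp {m : ℕ} (r : Pref m) (V : Finset (Fin m)) : Prop :=
  ∀ x ∈ V, ∀ y ∉ V, r.rel x y

/-- `S` is an initial or a final segment of the projects. -/
def IsRay {m : ℕ} (S : Finset (Fin m)) : Prop :=
  IsLowerSet (S : Set (Fin m)) ∨ IsUpperSet (S : Set (Fin m))

theorem isRay_Iic {m : ℕ} (p : Fin m) : IsRay (Finset.Iic p) := by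
  left; simpa using isLowerSet_Iic p

theorem isRay_Ioi {m : ℕ} (p : Fin m) : IsRay (Finset.Ioi p) := by
  right; simpa using isUpperSet_Ioi p

theorem isRay_Iio {m : ℕ} (p : Fin m) : IsRay (Finset.Iio p) := by
  left; simpa using isLowerSet_Iio p

theorem IsRay.mem_of_between {m : ℕ} {S : Finset (Fin m)} (hS : IsRay S) {x y z : Fin m}
    (hxy : x ≤ y) (hyz : y ≤ z) (hx : x ∈ S) (hz : z ∈ S) : y ∈ S := by
  rcases hS with h | h
  · simpa using h hyz (by simpa using hz)
  · simpa using h hxy (by simpa using hx)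

theorem Pref.eq_top {m : ℕ} [NeZero m] (r : Pref m) {a : Fin m} (h : ∀ b, r.rel a b) :
    r.top = a :=
  r.antisymm _ _ (r.top_spec a) (h _)

theorem Pref.rel_of_between {m : ℕ} [NeZero m] (r : Pref m) {x y : Fin m}
    (h : (r.top ≤ x ∧ x ≤ y) ∨ (y ≤ x ∧ x ≤ r.top)) : r.rel x y := by
  rcases eq_or_ne x y with rfl | hxy
  · exact r.refl _
  rcases eq_or_ne r.top x with h' | h'
  · rw [← h']; exact r.top_spec y
  refine r.singlePeaked _ r.top_spec _ _ ?_
  rcases h with ⟨h1, h2⟩ | ⟨h1, h2⟩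
  · exact Or.inl ⟨lt_of_le_of_ne h1 h', lt_of_le_of_ne h2 hxy⟩
  · exact Or.inr ⟨lt_of_le_of_ne h1 hxy.symm, lt_of_le_of_ne h2 h'.symm⟩

/-- Every project is the top of some single-peaked preference. -/
theorem Pref.exists_top_eq {m : ℕ} [NeZero m] (a : Fin m) : ∃ r : Pref m, r.top = a := by
  -- Rank by `key`, smaller being better: walk left from `a` to the end, using the values `0, …, a`,
  -- then right from `a + 1`.
  let key : Fin m → ℕ := fun x => if x ≤ a then a.1 - x.1 else x.1
  have key_inj : ∀ x y, key x = key y → x = y := by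
    intro x y h
    simp only [key, Fin.le_def] at h
    apply Fin.ext
    split_ifs at h <;> omega
  have hkey : ∀ y, key a ≤ key y := fun y => by simp [key]
  refine ⟨⟨fun x y => key x ≤ key y, fun _ => le_rfl, fun x y => le_total _ _,
    fun x y h h' => key_inj x y (le_antisymm h h'), fun _ _ _ h h' => h.trans h', ?_⟩,
    Pref.eq_top _ hkey⟩
  intro t ht p p' h
  have hta : t = a := key_inj _ _ (le_antisymm (ht a) (hkey t))
  subst hta
  simp only [key, Fin.le_def, Fin.lt_def] at *
  split_ifs <;> omega

/-- Some element of a nonempty set is worst in this set. -/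
theorem Pref.exists_worst {m : ℕ} (r : Pref m) {V : Finset (Fin m)} (hV : V.Nonempty) :
    ∃ p ∈ V, ∀ x ∈ V, r.rel x p := by
  -- The size of the upper contour set serves as rank: it grows strictly as projects get worse.
  obtain ⟨p, hp, h⟩ := V.exists_max_image (fun x => (r.upper x).card) hV
  refine ⟨p, hp, fun x hx => ?_⟩
  by_contra hne
  have hpx : r.rel p x := (r.total p x).resolve_right hne
  refine absurd (h x hx) (not_le.2 (Finset.card_lt_card ?_))
  rw [Finset.ssubset_iff_of_subset]
  · exact ⟨x, by simp [Pref.upper, r.refl], by simp [Pref.upper, hne]⟩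
  · intro z hz
    simp only [Pref.upper, Finset.mem_filter, Finset.mem_univ, true_and] at hz ⊢
    exact r.trans _ _ _ hz hpx

/-- Some element of a nonempty set is best in this set. -/
theorem Pref.exists_best {m : ℕ} (r : Pref m) {V : Finset (Fin m)} (hV : V.Nonempty) :
    ∃ p ∈ V, ∀ x ∈ V, r.rel p x := by
  obtain ⟨p, hp, h⟩ := V.exists_min_image (fun x => (r.upper x).card) hV
  refine ⟨p, hp, fun x hx => ?_⟩
  by_contra hne
  have hpx : r.rel x p := (r.total p x).resolve_left hne
  refine absurd (h x hx) (not_le.2 (Finset.card_lt_card ?_))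
  rw [Finset.ssubset_iff_of_subset]
  · exact ⟨p, by simp [Pref.upper, r.refl], by simp [Pref.upper, hne]⟩
  · intro z hz
    simp only [Pref.upper, Finset.mem_filter, Finset.mem_univ, true_and] at hz ⊢
    exact r.trans _ _ _ hz hpx

theorem Pref.isUp_upper {m : ℕ} (r : Pref m) (p : Fin m) : r.IsUp (r.upper p) := by
  intro x hx y hy
  simp only [Pref.upper, Finset.mem_filter, Finset.mem_univ, true_and] at hx hy
  exact r.trans _ _ _ hx ((r.total p y).resolve_right hy)

theorem Pref.isUp_upper_erase {m : ℕ} (r : Pref m) (p : Fin m) :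
    r.IsUp ((r.upper p).erase p) := by
  intro x hx y hy
  simp only [Pref.upper, Finset.mem_erase, Finset.mem_filter, Finset.mem_univ, true_and] at hx hy
  by_cases h : y = p
  · exact h ▸ hx.2
  · exact r.trans _ _ _ hx.2 ((r.total p y).resolve_right fun h' => hy ⟨h, h'⟩)

/-- Cut at the worst element. This makes strategy-proofness, stated for upper contour sets,
available for any `IsUp` set. -/
theorem Pref.IsUp.eq_upper {m : ℕ} {r : Pref m} {V : Finset (Fin m)} (h : r.IsUp V)
    (hV : V.Nonempty) : ∃ p, V = r.upper p := by
  obtain ⟨p, hp, hw⟩ := r.exists_worst hV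
  refine ⟨p, Finset.ext fun x => ⟨fun hx => by simpa [Pref.upper] using hw x hx, fun hx => ?_⟩⟩
  simp only [Pref.upper, Finset.mem_filter, Finset.mem_univ, true_and] at hx
  by_contra hxV
  exact hxV (r.antisymm _ _ hx (h p hp x hxV) ▸ hp)

/-- The preference `r` with the projects in the ray `V` moved before all others. -/
def Pref.promote {m : ℕ} [NeZero m] (r : Pref m) (V : Finset (Fin m)) (hV : IsRay V)
    (ht : r.top ∈ V) : Pref m where
  rel x y := (x ∈ V ∧ y ∉ V) ∨ ((x ∈ V ↔ y ∈ V) ∧ r.rel x y)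
  refl a := Or.inr ⟨Iff.rfl, r.refl a⟩
  total a b := by have := r.total a b; tauto
  antisymm a b h h' := by have := r.antisymm a b; tauto
  trans a b c h h' := by have := r.trans a b c; tauto
  singlePeaked a ha p p' h := by
    have hra : r.top = a := by
      have h1 := ha r.top
      have h2 := r.top_spec a
      have := r.antisymm r.top a
      tauto
    subst hra
    have h1 : r.rel p p' := r.singlePeaked _ r.top_spec p p' h
    have h2 : p' ∈ V → p ∈ V := fun hp' => by
      rcases h with h | h
      · exact hV.mem_of_between h.1.le h.2.le ht hp'
      · exact hV.mem_of_between h.1.le h.2.le hp' ht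
    tauto

theorem Pref.top_promote {m : ℕ} [NeZero m] (r : Pref m) (V : Finset (Fin m)) (hV : IsRay V)
    (ht : r.top ∈ V) : (r.promote V hV ht).top = r.top := by
  refine Pref.eq_top _ fun b => ?_
  have := r.top_spec b
  simp only [Pref.promote]
  tauto

theorem Pref.isUp_promote {m : ℕ} [NeZero m] (r : Pref m) (V : Finset (Fin m)) (hV : IsRay V)
    (ht : r.top ∈ V) : (r.promote V hV ht).IsUp V :=
  fun _ hx _ hy => Or.inl ⟨hx, hy⟩

theorem Pref.isUp_promote_of_subset {m : ℕ} [NeZero m] (r : Pref m) (V : Finset (Fin m))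
    (hV : IsRay V) (ht : r.top ∈ V) {U : Finset (Fin m)} (hU : r.IsUp U) (hUV : U ⊆ V) :
    (r.promote V hV ht).IsUp U := by
  intro x hx y hy
  have h1 := hUV hx
  have h2 := hU x hx y hy
  simp only [Pref.promote]
  tauto

/-- The preference `r` with the adjacent projects `c`, `b` on different sides of the top
exchanged. -/
def Pref.exchange {m : ℕ} [NeZero m] (r : Pref m) (b c : Fin m)
    (hadj : ∀ z, r.rel c z → r.rel z b → z = c ∨ z = b) (hcb : r.rel c b)
    (hside : (b < r.top ∧ r.top < c) ∨ (c < r.top ∧ r.top < b)) : Pref m where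
  rel x y := (x = b ∧ y = c) ∨ (r.rel x y ∧ ¬ (x = c ∧ y = b))
  refl a := Or.inr ⟨r.refl a, by
    rintro ⟨rfl, rfl⟩; rcases hside with h | h <;> exact absurd (h.1.trans h.2) (lt_irrefl _)⟩
  total x y := by have := r.total x y; tauto
  antisymm x y h h' := by
    have := r.antisymm x y
    have hbc : b ≠ c := by
      rintro rfl; rcases hside with h | h <;> exact absurd (h.1.trans h.2) (lt_irrefl _)
    grind
  trans x y z h h' := by
    have hbc : b ≠ c := by
      rintro rfl; rcases hside with h | h <;> exact absurd (h.1.trans h.2) (lt_irrefl _)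
    have h1 := r.trans x y z
    have h2 := r.trans c b z
    have h3 := r.trans x c b
    have h4 := hadj y
    have h5 := hadj z
    have h6 := hadj x
    have h7 := r.total x c
    have h8 := r.total b z
    have h9 := r.antisymm
    grind
  singlePeaked a ha p p' h := by
    have hbc : b ≠ c := by
      rintro rfl; rcases hside with h | h <;> exact absurd (h.1.trans h.2) (lt_irrefl _)
    have hra : r.top = a := by
      have h1 := ha r.top
      have h2 := r.top_spec a
      have := r.antisymm r.top a
      rcases h1 with ⟨h1, h3⟩ | h1
      · rcases hside with h | h
        · exact absurd h.2 (by rw [h3]; exact lt_irrefl _)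
        · exact absurd h.1 (by rw [h3]; exact lt_irrefl _)
      · exact this h2 h1.1
    subst hra
    refine Or.inr ⟨r.singlePeaked _ r.top_spec p p' h, ?_⟩
    -- Single-peakedness compares projects on one side of the top only, while `c` and `b` lie on
    -- different sides.
    rintro ⟨rfl, rfl⟩
    rcases h with h | h <;> rcases hside with h' | h'
    · exact absurd (h.1.trans h.2) h'.1.not_gt
    · exact absurd h.1 h'.1.not_gt
    · exact absurd h.2 h'.2.not_gt
    · exact absurd (h.1.trans h.2) h'.2.not_gt

theorem Pref.top_exchange {m : ℕ} [NeZero m] (r : Pref m) (b c : Fin m)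
    (hadj : ∀ z, r.rel c z → r.rel z b → z = c ∨ z = b) (hcb : r.rel c b)
    (hside : (b < r.top ∧ r.top < c) ∨ (c < r.top ∧ r.top < b)) :
    (r.exchange b c hadj hcb hside).top = r.top := by
  refine Pref.eq_top _ fun y => Or.inr ⟨r.top_spec y, ?_⟩
  rintro ⟨h, -⟩
  rcases hside with h' | h'
  · exact absurd h h'.2.ne
  · exact absurd h h'.1.ne'

theorem Pref.isUp_exchange {m : ℕ} [NeZero m] (r : Pref m) (b c : Fin m)
    (hadj : ∀ z, r.rel c z → r.rel z b → z = c ∨ z = b) (hcb : r.rel c b)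
    (hside : (b < r.top ∧ r.top < c) ∨ (c < r.top ∧ r.top < b)) {U : Finset (Fin m)}
    (hU : r.IsUp U) (h : b ∈ U ↔ c ∈ U) : (r.exchange b c hadj hcb hside).IsUp U := by
  intro x hx y hy
  refine Or.inr ⟨hU x hx y hy, ?_⟩
  rintro ⟨rfl, rfl⟩
  exact hy (h.2 hx)

/-! ### Strategy-proof and unanimous rules -/

/-- The probability of the set `S` at the profile `P`. -/
def mass {n m : ℕ} (φ : RSCR n m) (S : Finset (Fin m)) (P : Profile n m) : ℝ :=
  ∑ a ∈ S, (φ P).1 a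

theorem mass_univ {n m : ℕ} (φ : RSCR n m) (P : Profile n m) : mass φ Finset.univ P = 1 :=
  (φ P).2.2

theorem StrategyProof.mass_update_le {n m : ℕ} {φ : RSCR n m} (hφ : StrategyProof φ)
    {P : Profile n m} {i : Fin n} {V : Finset (Fin m)} (hV : (P i).IsUp V) (r' : Pref m) :
    mass φ V (Function.update P i r') ≤ mass φ V P := by
  rcases V.eq_empty_or_nonempty with rfl | hne
  · simp [mass]
  · obtain ⟨p, rfl⟩ := hV.eq_upper hne
    exact hφ i P r' p

theorem StrategyProof.mass_update_eq {n m : ℕ} {φ : RSCR n m} (hφ : StrategyProof φ)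
    {P : Profile n m} {i : Fin n} {V : Finset (Fin m)} {r' : Pref m} (hV : (P i).IsUp V)
    (hV' : r'.IsUp V) : mass φ V (Function.update P i r') = mass φ V P := by
  refine le_antisymm (hφ.mass_update_le hV r') ?_
  have h := hφ.mass_update_le (P := Function.update P i r') (i := i) (V := V) (by simpa using hV')
    (P i)
  simpa using h

/-- The changes at `b` and `c` cancel in total, so a set containing exactly one of them registers
the change up to sign. -/
theorem sum_eq_iff_of_eq_off_pair {m : ℕ} {v v' : Fin m → ℝ} {b c : Fin m} (hbc : b ≠ c)
    (h : ∀ z, z ≠ b → z ≠ c → v z = v' z) (hs : ∑ z, v z = ∑ z, v' z) {U : Finset (Fin m)}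
    (hU : (b ∈ U ∧ c ∉ U) ∨ (c ∈ U ∧ b ∉ U)) :
    ∑ z ∈ U, v z = ∑ z ∈ U, v' z ↔ v b = v' b := by
  have hd : ∀ z, z ≠ b → z ≠ c → v z - v' z = 0 := fun z h1 h2 => sub_eq_zero.2 (h z h1 h2)
  have htot : (v b - v' b) + (v c - v' c) = 0 := by
    rw [← Finset.sum_eq_add (s := Finset.univ) (f := fun z => v z - v' z) b c hbc
      (fun z _ hz => hd z hz.1 hz.2) (by simp) (by simp), Finset.sum_sub_distrib, hs, sub_self]
  rw [← sub_eq_zero, ← Finset.sum_sub_distrib]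
  rcases hU with ⟨h1, h2⟩ | ⟨h1, h2⟩
  · rw [Finset.sum_eq_single_of_mem b h1 fun z hz hzb => hd z hzb fun e => h2 (e ▸ hz)]
    exact sub_eq_zero
  · rw [Finset.sum_eq_single_of_mem c h1 fun z hz hzc => hd z (fun e => h2 (e ▸ hz)) hzc]
    constructor <;> intro h <;> linarith

/-- The upper sets of `r` ending at or just before a project other than `b` and `c` are upper sets
of `r'`. -/
def ExchangePair {m : ℕ} (r r' : Pref m) (b c : Fin m) : Prop :=
  ∀ z, z ≠ b → z ≠ c →
    r'.IsUp (r.upper z) ∧ r'.IsUp ((r.upper z).erase z)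

theorem Pref.exchangePair {m : ℕ} [NeZero m] (r : Pref m) (b c : Fin m)
    (hadj : ∀ z, r.rel c z → r.rel z b → z = c ∨ z = b) (hcb : r.rel c b)
    (hside : (b < r.top ∧ r.top < c) ∨ (c < r.top ∧ r.top < b)) :
    ExchangePair r (r.exchange b c hadj hcb hside) b c := by
  intro z hzb hzc
  have hiff : r.rel b z ↔ r.rel c z := by
    refine ⟨r.trans _ _ _ hcb, fun h => ?_⟩
    rcases r.total b z with h' | h'
    · exact h'
    · rcases hadj z h h' with h'' | h'' <;> contradiction
  exact ⟨r.isUp_exchange b c hadj hcb hside (r.isUp_upper z) (by simpa [Pref.upper] using hiff),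
    r.isUp_exchange b c hadj hcb hside (r.isUp_upper_erase z)
      (by simpa [Pref.upper, hzb.symm, hzc.symm] using hiff)⟩

/-- The probability of `z` is the difference of the masses of two sets that are upper sets of both
preferences. -/
theorem StrategyProof.eq_off_pair {n m : ℕ} {φ : RSCR n m} (hφ : StrategyProof φ)
    {r r' : Pref m} {b c : Fin m} (h : ExchangePair r r' b c) (Q : Profile n m) (i : Fin n)
    (z : Fin m) (hzb : z ≠ b) (hzc : z ≠ c) :
    (φ (Function.update Q i r)).1 z = (φ (Function.update Q i r')).1 z := by
  have key : ∀ V, r.IsUp V → r'.IsUp V →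
      mass φ V (Function.update Q i r) = mass φ V (Function.update Q i r') := by
    intro V h1 h2
    have := hφ.mass_update_eq (P := Function.update Q i r) (i := i) (V := V) (r' := r')
      (by simpa using h1) h2
    simpa using this.symm
  have h1 := key _ (r.isUp_upper z) (h z hzb hzc).1
  have h2 := key _ (r.isUp_upper_erase z) (h z hzb hzc).2
  have hz : z ∈ r.upper z := by simp [Pref.upper, r.refl]
  simp only [mass] at h1 h2
  rw [← Finset.sum_erase_add _ _ hz, ← Finset.sum_erase_add _ _ hz, h2] at h1
  exact add_left_cancel h1

theorem StrategyProof.mass_eq_iff {n m : ℕ} {φ : RSCR n m} (hφ : StrategyProof φ)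
    {r r' : Pref m} {b c : Fin m} (hbc : b ≠ c) (h : ExchangePair r r' b c) (Q : Profile n m)
    (i : Fin n) {U : Finset (Fin m)} (hU : (b ∈ U ∧ c ∉ U) ∨ (c ∈ U ∧ b ∉ U)) :
    mass φ U (Function.update Q i r) = mass φ U (Function.update Q i r') ↔
      (φ (Function.update Q i r)).1 b = (φ (Function.update Q i r')).1 b :=
  sum_eq_iff_of_eq_off_pair hbc (hφ.eq_off_pair h Q i)
    ((mass_univ φ _).trans (mass_univ φ _).symm) hU

/-- Whether voter `i`'s exchange matters can be read off the mass of any `U` separating `b` from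
`c`, and voter `j` cannot affect that mass while `U` stays an upper set. -/
theorem StrategyProof.prob_eq_iff_update {n m : ℕ} {φ : RSCR n m} (hφ : StrategyProof φ)
    {r r' : Pref m} {b c : Fin m} (hbc : b ≠ c) (h : ExchangePair r r' b c) (Q : Profile n m)
    {i j : Fin n} (hij : j ≠ i) {U : Finset (Fin m)} {s : Pref m}
    (hU : (b ∈ U ∧ c ∉ U) ∨ (c ∈ U ∧ b ∉ U)) (hQ : (Q j).IsUp U) (hs : s.IsUp U) :
    (φ (Function.update Q i r)).1 b = (φ (Function.update Q i r')).1 b ↔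
      (φ (Function.update (Function.update Q j s) i r)).1 b =
        (φ (Function.update (Function.update Q j s) i r')).1 b := by
  have key : ∀ t, mass φ U (Function.update (Function.update Q j s) i t) =
      mass φ U (Function.update Q i t) := by
    intro t
    rw [Function.update_comm hij]
    exact hφ.mass_update_eq (by simpa [hij] using hQ) hs
  rw [← hφ.mass_eq_iff hbc h Q i hU, ← hφ.mass_eq_iff hbc h _ i hU, key, key]

theorem Unanimous.prob_eq_zero {n m : ℕ} [NeZero m] {φ : RSCR n m} (hu : Unanimous φ)
    {P : Profile n m} {a b : Fin m} (h : ∀ i, (P i).top = a) (hb : b ≠ a) : (φ P).1 b = 0 := by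
  have h1 : (φ P).1 a = 1 := hu a P h
  have h2 := (φ P).2.2
  rw [← Finset.add_sum_erase _ _ (Finset.mem_univ a), h1] at h2
  have h3 : ∑ x ∈ Finset.univ.erase a, (φ P).1 x = 0 := by linarith
  exact (Finset.sum_eq_zero_iff_of_nonneg fun x _ => (φ P).2.1 x).1 h3 b (by simp [hb])

/-- Take the open ray ending at `c`. By single-peakedness, a project at or beyond `c` that is at
least as good as `b` would force `c` to be at least as good as `b`. -/
theorem Pref.isUp_separating {m : ℕ} [NeZero m] (r : Pref m) {a b c : Fin m}
    (hside : (b < a ∧ a < c) ∨ (c < a ∧ a < b)) (h : r.rel b c) :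
    ∃ V : Finset (Fin m), IsRay V ∧ a ∈ V ∧ b ∈ V ∧ c ∉ V ∧ r.upper b ⊆ V := by
  have hbc : b ≠ c := by
    rintro rfl; rcases hside with h | h <;> exact absurd (h.1.trans h.2) (lt_irrefl _)
  have hc : ¬ r.rel c b := fun h' => hbc (r.antisymm _ _ h h')
  rcases hside with ⟨h1, h2⟩ | ⟨h1, h2⟩
  · refine ⟨Finset.Iio c, isRay_Iio c, by simpa, by simpa using h1.trans h2, by simp, ?_⟩
    intro z hz
    simp only [Pref.upper, Finset.mem_filter, Finset.mem_univ, true_and, Finset.mem_Iio] at hz ⊢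
    by_contra hcz
    push Not at hcz
    rcases le_total r.top c with ht | ht
    · exact hc (r.trans _ _ _ (r.rel_of_between (Or.inl ⟨ht, hcz⟩)) hz)
    · exact hc (r.rel_of_between (Or.inr ⟨(h1.trans h2).le, ht⟩))
  · refine ⟨Finset.Ioi c, isRay_Ioi c, by simpa, by simpa using h1.trans h2, by simp, ?_⟩
    intro z hz
    simp only [Pref.upper, Finset.mem_filter, Finset.mem_univ, true_and, Finset.mem_Ioi] at hz ⊢
    by_contra hcz
    push Not at hcz
    rcases le_total r.top c with ht | ht
    · exact hc (r.rel_of_between (Or.inl ⟨ht, (h1.trans h2).le⟩))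
    · exact hc (r.trans _ _ _ (r.rel_of_between (Or.inr ⟨hcz, ht⟩)) hz)

/-- An exchange of two adjacent projects around the top does not change their probabilities. -/
theorem prob_eq_of_exchangePair {n m : ℕ} [NeZero m] {φ : RSCR n m} (hu : Unanimous φ)
    (hφ : StrategyProof φ) {r r' : Pref m} {a b c : Fin m} (hr : r.top = a) (hr' : r'.top = a)
    (hside : (b < a ∧ a < c) ∨ (c < a ∧ a < b)) (h : ExchangePair r r' b c) (i : Fin n)
    (Q : Profile n m) :
    (φ (Function.update Q i r)).1 b = (φ (Function.update Q i r')).1 b := by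
  have hbc : b ≠ c := by
    rintro rfl; rcases hside with h | h <;> exact absurd (h.1.trans h.2) (lt_irrefl _)
  have hba : b ≠ a := by rintro rfl; rcases hside with h | h <;> simp at h
  -- `T` collects the voters not yet moved to top `a`. Once it is empty, unanimity gives `b`
  -- probability zero before and after the exchange.
  suffices H : ∀ (T : Finset (Fin n)) (Q : Profile n m), (∀ j ∉ T, j ≠ i → (Q j).top = a) →
      (φ (Function.update Q i r)).1 b = (φ (Function.update Q i r')).1 b from
    H Finset.univ Q (by simp)
  intro T
  induction T using Finset.induction_on with
  | empty =>
    intro Q hQ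
    have key : ∀ s : Pref m, s.top = a → (φ (Function.update Q i s)).1 b = 0 := by
      intro s hs
      refine hu.prob_eq_zero (a := a) (fun j => ?_) hba
      by_cases hj : j = i
      · subst hj; simpa
      · simpa [hj] using hQ j (by simp) hj
    rw [key r hr, key r' hr']
  | insert j T _ ih =>
    intro Q hQ
    by_cases hji : j = i
    · exact ih Q fun k hk hki => hQ k (by simp [hk, hji, hki]) hki
    obtain ⟨V, hV, haV, hUV, hsepU, hsepV⟩ : ∃ V : Finset (Fin m), IsRay V ∧ a ∈ V ∧
        (∃ U, (Q j).IsUp U ∧ U ⊆ V ∧ ((b ∈ U ∧ c ∉ U) ∨ (c ∈ U ∧ b ∉ U))) ∧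
        (Q j).top ∈ V ∧ ((b ∈ V ∧ c ∉ V) ∨ (c ∈ V ∧ b ∉ V)) := by
      have hmem : ∀ z, z ∈ (Q j).upper z := fun z => by simp [Pref.upper, (Q j).refl]
      have htop : ∀ z, (Q j).top ∈ (Q j).upper z := fun z => by simp [Pref.upper, (Q j).top_spec]
      rcases (Q j).total b c with hbc' | hbc'
      · obtain ⟨V, h1, h2, h3, h4, h5⟩ := (Q j).isUp_separating hside hbc'
        exact ⟨V, h1, h2, ⟨_, (Q j).isUp_upper b, h5, Or.inl ⟨hmem b, fun hc => h4 (h5 hc)⟩⟩,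
          h5 (htop b), Or.inl ⟨h3, h4⟩⟩
      · obtain ⟨V, h1, h2, h3, h4, h5⟩ := (Q j).isUp_separating (a := a) (b := c) (c := b)
          (by tauto) hbc'
        exact ⟨V, h1, h2, ⟨_, (Q j).isUp_upper c, h5, Or.inr ⟨hmem c, fun hc => h4 (h5 hc)⟩⟩,
          h5 (htop c), Or.inr ⟨h3, h4⟩⟩
    obtain ⟨U, hU, hUV, hUsep⟩ := hUV
    obtain ⟨s, hs⟩ := Pref.exists_top_eq a
    have haV' : s.top ∈ V := hs ▸ haV
    -- Voter `j` is moved in two steps: promoting `V` keeps `U` an upper set; then `V`, now an upper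
    -- set itself, survives the switch to a preference with top `a`.
    rw [hφ.prob_eq_iff_update hbc h Q hji hUsep hU
        ((Q j).isUp_promote_of_subset V hV hsepU hU hUV),
      hφ.prob_eq_iff_update hbc h _ hji hsepV
        (by simpa using (Q j).isUp_promote V hV hsepU) (s.isUp_promote V hV haV'),
      Function.update_idem]
    refine ih _ fun k hk hki => ?_
    by_cases hkj : k = j
    · subst hkj; simp [Pref.top_promote, hs]
    · simpa [hkj] using hQ k (by simp [hk, hkj]) hki

/-- The pairs of a project in `S` and a better project outside `S`. -/
noncomputable def Pref.inversions {m : ℕ} (r : Pref m) (S : Finset (Fin m)) :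
    Finset (Fin m × Fin m) :=
  Finset.univ.filter fun z => z.1 ∈ S ∧ z.2 ∉ S ∧ r.rel z.2 z.1

/-- Bubble sort: each exchange lowers the number of inversions and preserves the mass of `S`.
Without inversions `S` is an upper set and strategy-proofness finishes. -/
theorem mass_update_eq_of_isRay {n m : ℕ} [NeZero m] {φ : RSCR n m} (hu : Unanimous φ)
    (hφ : StrategyProof φ) {S : Finset (Fin m)} (hS : IsRay S) {i : Fin n} {s : Pref m}
    (hs : s.IsUp S) (P : Profile n m) (hP : (P i).top ∈ S) :
    mass φ S (Function.update P i s) = mass φ S P := by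
  induction hk : ((P i).inversions S).card using Nat.strong_induction_on generalizing P with
  | _ k ih =>
  subst hk
  set r := P i with hr
  by_cases hup : r.IsUp S
  · exact hφ.mass_update_eq hup hs
  have hne : (Finset.univ.filter fun b => b ∈ S ∧ ∃ c ∉ S, r.rel c b).Nonempty := by
    simp only [Pref.IsUp] at hup
    push Not at hup
    obtain ⟨x, hx, y, hy, hxy⟩ := hup
    exact ⟨x, by simpa [hx] using ⟨y, hy, (r.total x y).resolve_left hxy⟩⟩
  obtain ⟨b, hb, hbest⟩ := r.exists_best hne
  simp only [Finset.mem_filter, Finset.mem_univ, true_and] at hb hbest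
  obtain ⟨hbS, c₀, hc₀, hcb₀⟩ := hb
  obtain ⟨c, hc, hworst⟩ := r.exists_worst (V := Finset.univ.filter fun c => c ∉ S ∧ r.rel c b)
    ⟨c₀, by simp [hc₀, hcb₀]⟩
  simp only [Finset.mem_filter, Finset.mem_univ, true_and] at hc hworst
  obtain ⟨hcS, hcb⟩ := hc
  -- The extremal choices of `b` and `c` leave no third project between them.
  have hadj : ∀ z, r.rel c z → r.rel z b → z = c ∨ z = b := by
    intro z h1 h2
    by_cases hz : z ∈ S
    · exact Or.inr (r.antisymm _ _ h2 (hbest z ⟨hz, c, hcS, h1⟩))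
    · exact Or.inl (r.antisymm _ _ (hworst z ⟨hz, h2⟩) h1)
  have hbc : b ≠ c := fun h => hcS (h ▸ hbS)
  have hnbc : ¬ r.rel b c := fun h => hbc (r.antisymm _ _ h hcb)
  have hside : (b < r.top ∧ r.top < c) ∨ (c < r.top ∧ r.top < b) := by
    rcases lt_or_ge c r.top with h | h
    · refine Or.inr ⟨h, lt_of_not_ge fun h' => ?_⟩
      rcases le_total b c with h'' | h''
      · exact hcS (hS.mem_of_between h'' h.le hbS hP)
      · exact hnbc (r.rel_of_between (Or.inr ⟨h'', h'⟩))
    · refine Or.inl ⟨lt_of_not_ge fun h' => ?_, lt_of_le_of_ne h fun h' => hcS (h' ▸ hP)⟩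
      rcases le_total b c with h'' | h''
      · exact hnbc (r.rel_of_between (Or.inl ⟨h', h''⟩))
      · exact hcS (hS.mem_of_between h h'' hP hbS)
  set e := r.exchange b c hadj hcb hside
  have hcard : (e.inversions S).card < (r.inversions S).card := by
    refine Finset.card_lt_card ?_
    rw [Finset.ssubset_iff_of_subset]
    · refine ⟨(b, c), by simp [Pref.inversions, hbS, hcS, hcb], ?_⟩
      simp [Pref.inversions, e, Pref.exchange, hbS, hcS, hbc.symm]
    · rintro ⟨x, y⟩ hxy
      simp only [Pref.inversions, Finset.mem_filter, Finset.mem_univ, true_and, e,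
        Pref.exchange] at hxy ⊢
      refine ⟨hxy.1, hxy.2.1, ?_⟩
      rcases hxy.2.2 with h | h
      · exact absurd (h.1 ▸ hbS) hxy.2.1
      · exact h.1
  have htop : e.top = r.top := r.top_exchange b c hadj hcb hside
  have h1 := ih _ (by simpa using hcard) (Function.update P i e) (by simpa [htop] using hP) rfl
  rw [Function.update_idem] at h1
  rw [h1]
  have hpair := r.exchangePair b c hadj hcb hside
  have h2 := (hφ.mass_eq_iff hbc hpair P i (Or.inl ⟨hbS, hcS⟩)).2
    (prob_eq_of_exchangePair hu hφ rfl htop hside hpair i P)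
  have h3 : Function.update P i r = P := Function.update_eq_self i P
  exact h2.symm.trans (by rw [h3])

/-- Moving the top of a voter into a ray does not decrease the probability of the ray. -/
theorem mass_le_update_of_isRay {n m : ℕ} [NeZero m] {φ : RSCR n m} (hu : Unanimous φ)
    (hφ : StrategyProof φ) {S : Finset (Fin m)} (hS : IsRay S) (i : Fin n) {s : Pref m}
    (hs : s.top ∈ S) (P : Profile n m) :
    mass φ S P ≤ mass φ S (Function.update P i s) := by
  have h1 := mass_update_eq_of_isRay hu hφ hS (i := i) (s.isUp_promote S hS hs)
    (Function.update P i s) (by simpa using hs)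
  have h2 := hφ.mass_update_le (P := Function.update P i (s.promote S hS hs)) (i := i) (V := S)
    (by simpa using s.isUp_promote S hS hs) (P i)
  rw [Function.update_idem] at h1
  rw [Function.update_idem, Function.update_eq_self] at h2
  exact h2.trans h1.le

/-! ### The distribution function depends only on the group counts -/

theorem mass_Iic_add_mass_Ioi {n m : ℕ} (φ : RSCR n m) (p : Fin m) (P : Profile n m) :
    mass φ (Finset.Iic p) P + mass φ (Finset.Ioi p) P = 1 := by
  rw [← mass_univ φ P, mass, mass, mass, ← Finset.sum_union]
  · congr 1
    ext z
    simpa using le_or_gt z p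
  · rw [Finset.disjoint_left]
    intro z hz
    simpa using hz

theorem mass_Iic_le_update {n m : ℕ} [NeZero m] {φ : RSCR n m} (hu : Unanimous φ)
    (hφ : StrategyProof φ) (p : Fin m) (P : Profile n m) (i : Fin n) (s : Pref m)
    (h : (P i).top ≤ p → s.top ≤ p) :
    mass φ (Finset.Iic p) P ≤ mass φ (Finset.Iic p) (Function.update P i s) := by
  by_cases hs : s.top ≤ p
  · exact mass_le_update_of_isRay hu hφ (isRay_Iic p) i (by simpa using hs) P
  -- Both tops lie beyond `p`: apply the ray lemma to `Ioi p`, in the reverse direction, and pass to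
  -- complements.
  · have hP : p < (P i).top := lt_of_not_ge fun h' => hs (h h')
    have h1 := mass_le_update_of_isRay hu hφ (isRay_Ioi p) i (s := P i) (by simpa using hP)
      (Function.update P i s)
    rw [Function.update_idem, Function.update_eq_self] at h1
    linarith [mass_Iic_add_mass_Ioi φ p P, mass_Iic_add_mass_Ioi φ p (Function.update P i s)]

theorem mass_Iic_mono {n m : ℕ} [NeZero m] {φ : RSCR n m} (hu : Unanimous φ)
    (hφ : StrategyProof φ) (p : Fin m) (P Q : Profile n m)
    (h : ∀ i, (P i).top ≤ p → (Q i).top ≤ p) :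
    mass φ (Finset.Iic p) P ≤ mass φ (Finset.Iic p) Q := by
  suffices H : ∀ T : Finset (Fin n),
      mass φ (Finset.Iic p) P ≤ mass φ (Finset.Iic p) (T.piecewise Q P) by
    simpa using H Finset.univ
  intro T
  induction T using Finset.induction_on with
  | empty => simp
  | insert j T hj ih =>
    rw [Finset.piecewise_insert]
    refine ih.trans (mass_Iic_le_update hu hφ p _ j _ ?_)
    simpa [hj] using h j

theorem countLE_restrict {n m : ℕ} [NeZero m] (P : Profile n m) (S : Finset (Fin n)) (p : Fin m) :
    countLE (P.restrict S) p = (S.filter fun i => (P i).top ≤ p).card := by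
  rw [countLE, ← Finset.card_map (Function.Embedding.subtype _)]
  congr 1
  ext i
  simp only [Finset.mem_map, Finset.mem_filter, Finset.mem_univ, true_and]
  constructor
  · rintro ⟨j, hj, rfl⟩
    exact ⟨j.2, hj⟩
  · rintro ⟨h1, h2⟩
    exact ⟨⟨i, h1⟩, h2, rfl⟩

/-- If every group has at least as many tops in `Iic p` at `Q` as at `P`, then `Iic p` is at least
as probable at `Q`. -/
theorem mass_Iic_le_of_countLE {n m g : ℕ} [NeZero m] {N : Fin g → Finset (Fin n)}
    (hN : IsPartition N) {φ : RSCR n m} (hu : Unanimous φ) (hφ : StrategyProof φ)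
    (ha : GroupwiseAnonymous N φ) (p : Fin m) (P Q : Profile n m)
    (h : ∀ q, countLE (P.restrict (N q)) p ≤ countLE (Q.restrict (N q)) p) :
    mass φ (Finset.Iic p) P ≤ mass φ (Finset.Iic p) Q := by
  simp only [countLE_restrict] at h
  induction hk : (Finset.univ.filter fun i => (P i).top ≤ p ∧ ¬ (Q i).top ≤ p).card using
    Nat.strong_induction_on generalizing P with
  | _ k ih =>
  subst hk
  by_cases hsub : ∀ i, (P i).top ≤ p → (Q i).top ≤ p
  · exact mass_Iic_mono hu hφ p P Q hsub
  push Not at hsub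
  obtain ⟨i, hiP, hiQ⟩ := hsub
  obtain ⟨q, hiq⟩ := hN.2 i
  -- Counting in the group of `i` supplies a voter with the opposite defect; swapping the two lowers
  -- the number of bad voters.
  obtain ⟨j, hjq, hjP, hjQ⟩ : ∃ j ∈ N q, p < (P j).top ∧ (Q j).top ≤ p := by
    by_contra hcon
    push Not at hcon
    refine absurd (h q) (not_le.2 (Finset.card_lt_card ?_))
    rw [Finset.ssubset_iff_of_subset]
    · exact ⟨i, by simp [hiq, hiP], by simpa [hiq] using hiQ⟩
    · intro j hj
      simp only [Finset.mem_filter] at hj ⊢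
      refine ⟨hj.1, ?_⟩
      by_contra hjP
      exact absurd hj.2 (not_le.2 (hcon j hj.1 (not_le.1 hjP)))
  have hgp : GroupPreserving N (Equiv.swap i j) := by
    intro q' k hk
    by_cases hqq : q' = q
    · subst hqq
      rcases eq_or_ne k i with rfl | hki
      · simpa using hjq
      rcases eq_or_ne k j with rfl | hkj
      · simpa using hiq
      rwa [Equiv.swap_apply_of_ne_of_ne hki hkj]
    · have hd := Finset.disjoint_left.1 (hN.1 q' q hqq) hk
      rwa [Equiv.swap_apply_of_ne_of_ne (by rintro rfl; exact hd hiq)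
        (by rintro rfl; exact hd hjq)]
  have hgp' : ∀ q, ∀ k, Equiv.swap i j k ∈ N q ↔ k ∈ N q := fun q k =>
    ⟨fun hk => by simpa using hgp q _ hk, hgp q k⟩
  have hmass : mass φ (Finset.Iic p) P = mass φ (Finset.Iic p) (fun k => P (Equiv.swap i j k)) := by
    rw [mass, ha _ hgp P, mass]
  rw [hmass]
  refine ih _ ?_ _ ?_ rfl
  · refine Finset.card_lt_card ?_
    rw [Finset.ssubset_iff_of_subset]
    · exact ⟨i, by simpa [hiP] using hiQ, by simpa using fun h => absurd h (not_le.2 hjP)⟩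
    · intro k hk
      simp only [Finset.mem_filter, Finset.mem_univ, true_and] at hk ⊢
      rcases eq_or_ne k i with rfl | hki
      · exact ⟨hiP, not_le.2 hiQ⟩
      rcases eq_or_ne k j with rfl | hkj
      · exact absurd hjQ hk.2
      rwa [Equiv.swap_apply_of_ne_of_ne hki hkj] at hk
  · intro q'
    refine le_trans (le_of_eq ?_) (h q')
    refine Finset.card_equiv (Equiv.swap i j) fun k => ?_
    simp [hgp']

/-- The group counts of tops at or before `p`. -/
noncomputable def counts {n m g : ℕ} [NeZero m] (N : Fin g → Finset (Fin n)) (P : Profile n m)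
    (p : Fin m) : Gam N :=
  fun q => ⟨countLE (P.restrict (N q)) p, Nat.lt_succ_of_le
    ((Finset.card_le_univ _).trans (by simp))⟩

/-- The group counts of tops strictly before `p`. -/
noncomputable def countsLT {n m g : ℕ} [NeZero m] (N : Fin g → Finset (Fin n)) (P : Profile n m)
    (p : Fin m) : Gam N :=
  fun q => ⟨countLT (P.restrict (N q)) p, Nat.lt_succ_of_le
    ((Finset.card_le_univ _).trans (by simp))⟩

theorem countLE_mono {n m : ℕ} [NeZero m] {S : Finset (Fin n)} (P : SubProfile S m) {p p' : Fin m}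
    (h : p ≤ p') : countLE P p ≤ countLE P p' := by
  refine Finset.card_le_card fun i hi => ?_
  simp only [Finset.mem_filter, Finset.mem_univ, true_and] at hi ⊢
  exact hi.trans h

theorem countLT_eq_countLE {n m : ℕ} [NeZero m] {S : Finset (Fin n)} (P : SubProfile S m)
    {p p' : Fin m} (h : (p : ℕ) = p' + 1) : countLT P p = countLE P p' := by
  unfold countLT countLE
  congr 1
  ext i
  simp only [Finset.mem_filter, Finset.mem_univ, true_and, Fin.lt_def, Fin.le_def]
  omega

theorem countLT_le_countLE {n m : ℕ} [NeZero m] {S : Finset (Fin n)} (P : SubProfile S m)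
    (p : Fin m) : countLT P p ≤ countLE P p := by
  refine Finset.card_le_card fun i hi => ?_
  simp only [Finset.mem_filter, Finset.mem_univ, true_and] at hi ⊢
  exact hi.le

theorem countsLT_eq_counts {n m g : ℕ} [NeZero m] (N : Fin g → Finset (Fin n)) (P : Profile n m)
    {p p' : Fin m} (h : (p : ℕ) = p' + 1) : countsLT N P p = counts N P p' := by
  funext q
  exact Fin.ext (countLT_eq_countLE _ h)

/-! ### Group min-max rules -/

theorem tau_le_iff {n m : ℕ} [NeZero m] {S : Finset (Fin n)} (P : SubProfile S m)
    (t : Fin (S.card + 1)) (p : Fin m) : tau P t ≤ p ↔ (t : ℕ) ≤ countLE P p := by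
  constructor
  · intro h
    have := Finset.min'_mem _ (tau_aux P t)
    simp only [Finset.mem_filter, Finset.mem_univ, true_and] at this
    exact this.trans (countLE_mono P h)
  · intro h
    exact Finset.min'_le _ _ (by simpa using h)

/-- The vectors `γ` with all `tau` values at most `p` are those below `counts N P p`; as `β` is
antitone, the largest such vector decides. -/
theorem inf'_max_tau_le_iff {n m g : ℕ} [NeZero m] {N : Fin g → Finset (Fin n)}
    {β : Gam N → Fin m} (hβ : ∀ γ γ' : Gam N, γ' ≤ γ → β γ ≤ β γ') (P : Profile n m) (p : Fin m) :
    (Finset.univ.inf' Finset.univ_nonempty fun γ : Gam N =>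
      max (Finset.univ.sup fun q => tau (P.restrict (N q)) (γ q)) (β γ)) ≤ p ↔
      β (counts N P p) ≤ p := by
  rw [Finset.inf'_le_iff]
  simp only [Finset.mem_univ, true_and, max_le_iff, Finset.sup_le_iff, forall_const, tau_le_iff]
  constructor
  · rintro ⟨γ, h1, h2⟩
    exact (hβ _ _ fun q => h1 q).trans h2
  · intro h
    exact ⟨counts N P p, fun q => le_rfl, h⟩

theorem IsGroupMinMax.le_iff {n m g : ℕ} [NeZero m] {N : Fin g → Finset (Fin n)}
    {β : Gam N → Fin m} {f : DSCR n m} (h : IsGroupMinMax N β f) (P : Profile n m) (p : Fin m) :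
    f P ≤ p ↔ β (counts N P p) ≤ p := by
  rw [h.2.2.2 P]
  exact inf'_max_tau_le_iff h.2.2.1 P p

theorem IsGroupMinMax.eq_iff {n m g : ℕ} [NeZero m] {N : Fin g → Finset (Fin n)}
    {β : Gam N → Fin m} {f : DSCR n m} (h : IsGroupMinMax N β f) (P : Profile n m) (p : Fin m) :
    f P = p ↔ p ≤ β (countsLT N P p) ∧ β (counts N P p) ≤ p := by
  rw [← h.le_iff P p]
  by_cases hp : p = ⊥
  · subst hp; simp
  · have hp0 : (p : ℕ) ≠ 0 := fun h0 =>
      hp (le_bot_iff.1 (by rw [Fin.le_def, h0]; exact Nat.zero_le _))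
    let p' : Fin m := ⟨p - 1, by omega⟩
    have hpp : (p : ℕ) = p' + 1 := by simp only [p']; omega
    have hlt : ∀ x : Fin m, p ≤ x ↔ ¬ x ≤ p' := by
      intro x
      simp only [Fin.le_def]
      omega
    rw [countsLT_eq_counts N P hpp, hlt, ← h.le_iff P p', ← hlt]
    exact ⟨fun e => by simp [e], fun e => le_antisymm e.2 e.1⟩

theorem IsGroupMinMax.unanimous {n m g : ℕ} [NeZero m] {N : Fin g → Finset (Fin n)}
    {β : Gam N → Fin m} {f : DSCR n m} (h : IsGroupMinMax N β f) (P : Profile n m) (p : Fin m)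
    (hP : ∀ i, (P i).top = p) : f P = p := by
  rw [h.eq_iff]
  have h1 : countsLT N P p = fun _ => 0 := by
    funext q
    exact Fin.ext (by simp [countsLT, countLT, Profile.restrict, hP])
  have h2 : counts N P p = fun q => Fin.last (N q).card := by
    funext q
    exact Fin.ext (by simp [counts, countLE, Profile.restrict, hP])
  rw [h1, h2, h.1, h.2.1]
  exact ⟨le_top, bot_le⟩

theorem counts_le_update {n m g : ℕ} [NeZero m] (N : Fin g → Finset (Fin n)) (P : Profile n m)
    (i : Fin n) (s : Pref m) {p : Fin m} (h : (P i).top ≤ p → s.top ≤ p) :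
    counts N P p ≤ counts N (Function.update P i s) p := by
  intro q
  change countLE _ _ ≤ countLE _ _
  rw [countLE_restrict, countLE_restrict]
  refine Finset.card_le_card fun j hj => ?_
  simp only [Finset.mem_filter] at hj ⊢
  refine ⟨hj.1, ?_⟩
  rcases eq_or_ne j i with rfl | hji
  · simpa using h hj.2
  · simpa [hji] using hj.2

theorem update_counts_le {n m g : ℕ} [NeZero m] (N : Fin g → Finset (Fin n)) (P : Profile n m)
    (i : Fin n) (s : Pref m) {p : Fin m} (h : s.top ≤ p → (P i).top ≤ p) :
    counts N (Function.update P i s) p ≤ counts N P p := by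
  have := counts_le_update N (Function.update P i s) i (P i) (p := p) (by simpa using h)
  simpa using this

/-- A misreport can only push the outcome further from the voter's top on the side where it already
is, or past the top; an outcome at the top is already best. -/
theorem IsGroupMinMax.rel_update {n m g : ℕ} [NeZero m] {N : Fin g → Finset (Fin n)}
    {β : Gam N → Fin m} {f : DSCR n m} (h : IsGroupMinMax N β f) (P : Profile n m) (i : Fin n)
    (s : Pref m) : (P i).rel (f P) (f (Function.update P i s)) := by
  have up : ∀ p, (P i).top ≤ p → f (Function.update P i s) ≤ p → f P ≤ p := fun p hp hf => by
    rw [h.le_iff] at hf ⊢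
    exact (h.2.2.1 _ _ (update_counts_le N P i s fun _ => hp)).trans hf
  have down : ∀ p, p < (P i).top → f P ≤ p → f (Function.update P i s) ≤ p := fun p hp hf => by
    rw [h.le_iff] at hf ⊢
    exact (h.2.2.1 _ _ (counts_le_update N P i s fun h' => absurd hp (not_lt.2 h'))).trans hf
  rcases lt_or_ge (f P) (P i).top with h1 | h1
  · exact (P i).rel_of_between (Or.inr ⟨down _ h1 le_rfl, h1.le⟩)
  rcases le_total (P i).top (f (Function.update P i s)) with h2 | h2
  · exact (P i).rel_of_between (Or.inl ⟨h1, up _ h2 le_rfl⟩)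
  · rw [le_antisymm (up _ le_rfl h2) h1]
    exact (P i).top_spec _

/-! ### Profiles with prescribed group counts -/

theorem exists_rank {n : ℕ} (S : Finset (Fin n)) :
    ∃ rk : Fin n → ℕ, ∀ k ≤ S.card, (S.filter fun i => rk i < k).card = k := by
  refine ⟨fun i => if h : i ∈ S then S.equivFin ⟨i, h⟩ else 0, fun k hk => ?_⟩
  calc _ = (Finset.range k).card := by
        refine Finset.card_bij'
          (fun i hi => ((S.equivFin ⟨i, (Finset.mem_filter.1 hi).1⟩ : Fin _) : ℕ))
          (fun j hj => (S.equivFin.symm ⟨j, (Finset.mem_range.1 hj).trans_le hk⟩ : {i // i ∈ S}).1)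
          ?_ ?_ ?_ ?_
        · intro i hi
          obtain ⟨h1, h2⟩ := Finset.mem_filter.1 hi
          simpa [h1] using h2
        · intro j hj
          simpa using hj
        · intro i hi
          simp
        · intro j hj
          simp
    _ = k := Finset.card_range k

/-- Voters can be labelled by their group and by a rank inside their group. -/
theorem IsPartition.exists_group_rank {n g : ℕ} {N : Fin g → Finset (Fin n)}
    (hN : IsPartition N) : ∃ (grp : Fin n → Fin g) (rk : Fin n → ℕ),
      (∀ q, ∀ i ∈ N q, grp i = q) ∧
      ∀ q, ∀ k ≤ (N q).card, ((N q).filter fun i => rk i < k).card = k := by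
  choose grp hgrp using hN.2
  choose rk hrk using fun q => exists_rank (N q)
  have huniq : ∀ q, ∀ i ∈ N q, grp i = q := by
    intro q i hi
    by_contra hne
    exact Finset.disjoint_left.1 (hN.1 _ _ hne) (hgrp i) hi
  refine ⟨grp, fun i => rk (grp i) i, huniq, fun q k hk => ?_⟩
  refine Eq.trans ?_ (hrk q k hk)
  congr 1
  refine Finset.filter_congr fun i hi => ?_
  simp only [huniq q i hi]

theorem IsPartition.exists_profile_counts {n m g : ℕ} [NeZero m] {N : Fin g → Finset (Fin n)}
    (hN : IsPartition N) (γ : Gam N) :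
    ∃ Q : Profile n m, ∀ p, p ≠ ⊤ → counts N Q p = γ := by
  obtain ⟨grp, rk, huniq, hrk⟩ := hN.exists_group_rank
  choose pref hpref using fun a : Fin m => Pref.exists_top_eq a
  -- The first `γ q` voters of each group sit at `⊥`, the others at `⊤`.
  refine ⟨fun i => pref (if rk i < γ (grp i) then ⊥ else ⊤), fun p hp => ?_⟩
  funext q
  apply Fin.ext
  change countLE _ p = _
  rw [countLE_restrict, ← hrk q (γ q) (Nat.lt_succ_iff.1 (γ q).2)]
  congr 1
  refine Finset.filter_congr fun i hi => ?_
  rw [hpref, huniq q i hi]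
  split_ifs with h <;> simp [h, hp]

/-! ### Convex combinations of deterministic rules -/

theorem eq_of_sum_Iic_eq {m : ℕ} {x y : Fin m → ℝ}
    (h : ∀ p, ∑ a ∈ Finset.Iic p, x a = ∑ a ∈ Finset.Iic p, y a) (p : Fin m) : x p = y p := by
  induction p using WellFoundedLT.induction with
  | _ p ih =>
  have h1 := h p
  rw [← Finset.Iio_insert, Finset.sum_insert (by simp), Finset.sum_insert (by simp),
    Finset.sum_congr rfl fun a ha => ih a (Finset.mem_Iio.1 ha)] at h1
  exact add_right_cancel h1

theorem sum_prob_eq_sum_ite {n m r : ℕ} (lam : Fin r → ℝ) (f : Fin r → DSCR n m)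
    (P : Profile n m) (U : Finset (Fin m)) :
    ∑ p ∈ U, ∑ w with f w P = p, lam w = ∑ w, if f w P ∈ U then lam w else 0 := by
  simp only [Finset.sum_filter]
  rw [Finset.sum_comm]
  refine Finset.sum_congr rfl fun w _ => ?_
  simp

section Mixture

variable {n m g r : ℕ} [NeZero m] {N : Fin g → Finset (Fin n)} {φ : RSCR n m}
  {lam : Fin r → ℝ} {f : Fin r → DSCR n m} {β : Fin r → Gam N → Fin m}

theorem IsGroupMinMaxMixture.mass_eq (h : IsGroupMinMaxMixture N φ lam f β) (U : Finset (Fin m))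
    (P : Profile n m) : mass φ U P = ∑ w, if f w P ∈ U then lam w else 0 := by
  rw [← sum_prob_eq_sum_ite]
  exact Finset.sum_congr rfl fun p _ => h.2.2.2 P p

theorem IsGroupMinMaxMixture.isGroupMinMax (h : IsGroupMinMaxMixture N φ lam f β) {w : Fin r}
    (hw : lam w ≠ 0) : IsGroupMinMax N (β w) (f w) :=
  h.2.2.1 w (lt_of_le_of_ne (h.1 w).1 hw.symm)

theorem IsGroupMinMaxMixture.unanimous (h : IsGroupMinMaxMixture N φ lam f β) : Unanimous φ := by
  intro p P hP
  rw [h.2.2.2, ← h.2.1]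
  exact Finset.sum_filter_of_ne fun w _ hw => (h.isGroupMinMax hw).unanimous P p hP

theorem IsGroupMinMaxMixture.strategyProof (h : IsGroupMinMaxMixture N φ lam f β) :
    StrategyProof φ := by
  intro i P s p
  change mass φ _ _ ≤ mass φ _ _
  rw [h.mass_eq, h.mass_eq]
  refine Finset.sum_le_sum fun w _ => ?_
  rcases eq_or_ne (lam w) 0 with hw | hw
  · simp [hw]
  have hrel := (h.isGroupMinMax hw).rel_update P i s
  have := (h.1 w).1
  simp only [Pref.upper, Finset.mem_filter, Finset.mem_univ, true_and]
  split_ifs with h1 h2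
  · exact le_rfl
  · exact absurd ((P i).trans _ _ _ hrel h1) h2
  · exact this
  · exact le_rfl

theorem counts_comp_perm {π : Equiv.Perm (Fin n)} (hπ : GroupPreserving N π) (P : Profile n m)
    (p : Fin m) : counts N (fun i => P (π i)) p = counts N P p := by
  have hiff : ∀ q i, π i ∈ N q ↔ i ∈ N q := by
    intro q i
    refine ⟨fun hi => ?_, hπ q i⟩
    have himg : (N q).image π = N q :=
      Finset.eq_of_subset_of_card_le (Finset.image_subset_iff.2 (hπ q))
        (Finset.card_image_of_injective _ π.injective).ge
    rw [← himg] at hi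
    simpa using hi
  funext q
  apply Fin.ext
  change countLE _ _ = countLE _ _
  rw [countLE_restrict, countLE_restrict]
  exact Finset.card_equiv π fun i => by simp [hiff]

theorem IsGroupMinMaxMixture.groupwiseAnonymous (h : IsGroupMinMaxMixture N φ lam f β) :
    GroupwiseAnonymous N φ := by
  intro π hπ P
  apply Subtype.ext
  funext p
  rw [h.2.2.2, h.2.2.2, Finset.sum_filter, Finset.sum_filter]
  refine Finset.sum_congr rfl fun w _ => ?_
  rcases eq_or_ne (lam w) 0 with hw | hw
  · simp [hw]
  have hf : f w P = f w fun i => P (π i) := by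
    refine eq_of_forall_ge_iff fun a => ?_
    rw [(h.isGroupMinMax hw).le_iff, (h.isGroupMinMax hw).le_iff, counts_comp_perm hπ]
  rw [hf]

theorem IsGroupMinMaxMixture.prob_eq (h : IsGroupMinMaxMixture N φ lam f β) (P : Profile n m)
    (p : Fin m) :
    (φ P).1 p = ∑ w with p ≤ β w (countsLT N P p) ∧ β w (counts N P p) ≤ p, lam w := by
  rw [h.2.2.2, Finset.sum_filter, Finset.sum_filter]
  refine Finset.sum_congr rfl fun w _ => ?_
  rcases eq_or_ne (lam w) 0 with hw | hw
  · simp [hw]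
  simp only [(h.isGroupMinMax hw).eq_iff]

end Mixture

/-! ### Decomposition of random rules -/

/-- Finitely many nonnegative levels are reached by adding up finitely many layers. -/
theorem exists_layers (T : Finset ℝ) (hT : ∀ t ∈ T, 0 ≤ t) :
    ∃ (r : ℕ) (lam u : Fin r → ℝ), (∀ k, 0 ≤ lam k) ∧ (∀ k, 0 < u k ∧ u k ∈ T) ∧
      (∑ k, lam k = 0 ∨ ∑ k, lam k ∈ T) ∧
      ∀ v ∈ T, (∑ k, if u k ≤ v then lam k else 0) = v := by
  induction T using Finset.induction_on_max with
  | empty => exact ⟨0, Fin.elim0, Fin.elim0, fun k => k.elim0, fun k => k.elim0, by simp, by simp⟩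
  | insert v₀ T hmax ih =>
    obtain ⟨r, lam, u, h1, h2, h3, h4⟩ := ih fun t ht => hT t (Finset.mem_insert_of_mem ht)
    have hv₀ := hT v₀ (Finset.mem_insert_self _ _)
    -- The clause that the total is `0` or a level is carried for this bound, which makes the new
    -- weight `v₀ - ∑ k, lam k` nonnegative.
    have hsum : ∑ k, lam k ≤ v₀ := by
      rcases h3 with h3 | h3
      · rw [h3]; exact hv₀
      · exact (hmax _ h3).le
    rcases hv₀.eq_or_lt with hz | hpos
    · refine ⟨0, Fin.elim0, Fin.elim0, fun k => k.elim0, fun k => k.elim0, by simp, ?_⟩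
      intro v hv
      rcases Finset.mem_insert.1 hv with rfl | hv'
      · simpa using hz
      · have := hmax v hv'
        have := hT v hv
        linarith
    · refine ⟨r + 1, Fin.cons (v₀ - ∑ k, lam k) lam, Fin.cons v₀ u, ?_, ?_, Or.inr ?_, ?_⟩
      · refine Fin.cases ?_ ?_
        · simpa using hsum
        · simpa using h1
      · refine Fin.cases ?_ ?_
        · simpa using hpos
        · intro k
          simpa using ⟨(h2 k).1, Or.inr (h2 k).2⟩
      · simp [Fin.sum_univ_succ]
      · intro v hv
        rw [Fin.sum_univ_succ]
        simp only [Fin.cons_zero, Fin.cons_succ]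
        rcases Finset.mem_insert.1 hv with rfl | hv'
        · simp [fun k => (hmax _ (h2 k).2).le]
        · rw [if_neg (not_le.2 (hmax v hv')), zero_add, h4 v hv']

theorem mass_Iic_top {n m : ℕ} [NeZero m] (φ : RSCR n m) (P : Profile n m) :
    mass φ (Finset.Iic ⊤) P = 1 := by
  rw [Finset.Iic_top, mass_univ]

/-- A unanimous, strategy-proof and group-wise anonymous random rule is a random group min-max
rule. -/
theorem exists_isGroupMinMaxMixture {n m g : ℕ} [NeZero m] {N : Fin g → Finset (Fin n)}
    (hN : IsPartition N) {φ : RSCR n m} (hu : Unanimous φ) (hφ : StrategyProof φ)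
    (ha : GroupwiseAnonymous N φ) :
    ∃ (r : ℕ) (lam : Fin r → ℝ) (f : Fin r → DSCR n m) (β : Fin r → Gam N → Fin m),
      IsGroupMinMaxMixture N φ lam f β := by
  choose Q hQ using fun γ : Gam N => hN.exists_profile_counts (m := m) γ
  set B : Gam N → Fin m → ℝ := fun γ p => mass φ (Finset.Iic p) (Q γ) with hB
  have hle : ∀ P P' p, counts N P p ≤ counts N P' p →
      mass φ (Finset.Iic p) P ≤ mass φ (Finset.Iic p) P' := fun P P' p h =>
    mass_Iic_le_of_countLE hN hu hφ ha p P P' fun q => h q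
  have hBP : ∀ P p, B (counts N P p) p = mass φ (Finset.Iic p) P := by
    intro P p
    -- At `⊤` every top is counted, so `Q γ` need not have counts `γ`; but the mass is `1`
    -- regardless.
    by_cases hp : p = ⊤
    · subst hp
      simp only [hB, mass_Iic_top]
    · exact le_antisymm (hle _ _ _ (hQ _ p hp).le) (hle _ _ _ (hQ _ p hp).ge)
  have hBγ : ∀ γ γ' p, γ' ≤ γ → B γ' p ≤ B γ p := by
    intro γ γ' p h
    by_cases hp : p = ⊤
    · subst hp
      simp only [hB, mass_Iic_top, le_refl]
    · exact hle _ _ _ (by rw [hQ _ p hp, hQ _ p hp]; exact h)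
  have hBp : ∀ γ, Monotone (B γ) := fun γ p p' h =>
    Finset.sum_le_sum_of_subset_of_nonneg (Finset.Iic_subset_Iic.2 h)
      fun a _ _ => (φ (Q γ)).2.1 a
  have hBtop : ∀ γ, B γ ⊤ = 1 := fun γ => mass_Iic_top φ _
  have hB0 : ∀ γ p, 0 ≤ B γ p := fun γ p => Finset.sum_nonneg fun a _ => (φ (Q γ)).2.1 a
  choose pref hpref using fun a : Fin m => Pref.exists_top_eq a
  have hBzero : ∀ p, p ≠ ⊤ → B (fun _ => 0) p = 0 := by
    intro p hp
    have hc : counts N (fun _ => pref ⊤) p = fun _ => 0 := by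
      funext q
      apply Fin.ext
      simp [counts, countLE, Profile.restrict, hpref, hp]
    rw [← hc, hBP]
    refine Finset.sum_eq_zero fun a ha => ?_
    refine hu.prob_eq_zero (a := ⊤) (fun i => hpref _) ?_
    rintro rfl
    exact hp (top_le_iff.1 (Finset.mem_Iic.1 ha))
  have hBlast : ∀ p, B (fun q => Fin.last (N q).card) p = 1 := by
    intro p
    have hc : counts N (fun _ => pref ⊥) p = fun q => Fin.last (N q).card := by
      funext q
      apply Fin.ext
      simp [counts, countLE, Profile.restrict, hpref]
    refine le_antisymm ((hBp _ le_top).trans (hBtop _).le) ?_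
    rw [← hc, hBP, ← hu ⊥ (fun _ => pref ⊥) fun _ => hpref _]
    exact Finset.single_le_sum (f := (φ fun _ => pref ⊥).1) (fun a _ => (φ _).2.1 a) (by simp)
  obtain ⟨r, lam, u, hlam, hu', -, hlayer⟩ :=
    exists_layers (Finset.univ.image fun z : Gam N × Fin m => B z.1 z.2) (by
      intro t ht
      obtain ⟨z, -, rfl⟩ := Finset.mem_image.1 ht
      exact hB0 _ _)
  have hlayer' : ∀ γ p, (∑ k, if u k ≤ B γ p then lam k else 0) = B γ p := fun γ p =>
    hlayer _ (Finset.mem_image.2 ⟨(γ, p), Finset.mem_univ _, rfl⟩)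
  have hu1 : ∀ k, u k ≤ 1 := by
    intro k
    obtain ⟨z, -, hz⟩ := Finset.mem_image.1 (hu' k).2
    rw [← hz, ← hBtop z.1]
    exact hBp _ le_top
  -- The quantile of `B γ` at level `u k`; it exists because `u k ≤ 1 = B γ ⊤`.
  have hex : ∀ k γ, ∃ b, ∀ p, b ≤ p ↔ u k ≤ B γ p := by
    intro k γ
    have hne : (Finset.univ.filter fun p => u k ≤ B γ p).Nonempty :=
      ⟨⊤, by simpa [hBtop] using hu1 k⟩
    refine ⟨Finset.min' _ hne, fun p => ⟨fun h => ?_, fun h => Finset.min'_le _ _ (by simpa)⟩⟩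
    have := Finset.min'_mem _ hne
    simp only [Finset.mem_filter, Finset.mem_univ, true_and] at this
    exact this.trans (hBp γ h)
  choose β hβ using hex
  set f : Fin r → DSCR n m := fun k P => Finset.univ.inf' Finset.univ_nonempty fun γ : Gam N =>
    max (Finset.univ.sup fun q => tau (P.restrict (N q)) (γ q)) (β k γ)
  have hmin : ∀ k, IsGroupMinMax N (β k) (f k) := by
    intro k
    refine ⟨?_, ?_, ?_, fun P => rfl⟩
    · by_contra hne
      have := (hβ k (fun _ => 0) _).1 le_rfl
      rw [hBzero _ hne] at this
      exact absurd (hu' k).1 (not_lt.2 this)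
    · rw [← le_bot_iff, hβ, hBlast]
      exact hu1 k
    · intro γ γ' h
      rw [hβ]
      exact ((hβ k γ' _).1 le_rfl).trans (hBγ _ _ _ h)
  have hsum : ∑ k, lam k = 1 := by
    have := hlayer' (fun _ => 0) ⊤
    simpa [hBtop, hu1] using this
  refine ⟨r, lam, f, β, fun k => ⟨hlam k, ?_⟩, hsum, fun k _ => hmin k, fun P p => ?_⟩
  · rw [← hsum]
    exact Finset.single_le_sum (fun j _ => hlam j) (Finset.mem_univ k)
  · refine eq_of_sum_Iic_eq (y := fun p => ∑ w with f w P = p, lam w) (fun a => ?_) p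
    rw [sum_prob_eq_sum_ite]
    simp only [Finset.mem_Iic, (hmin _).le_iff, hβ]
    rw [hlayer', hBP, mass]

/-! ### The entitlement guarantee -/

theorem mem_iff_of_ordConnected {m k : ℕ} {S : Finset (Fin m)} (hc : S.card = k)
    (ho : (S : Set (Fin m)).OrdConnected) {x : Fin m} (hx : IsLeast (S : Set (Fin m)) x)
    (y : Fin m) : y ∈ S ↔ x ≤ y ∧ (y : ℕ) < x + k := by
  have hxS : x ∈ S := hx.1
  have hS : S = Finset.Icc x (S.max' ⟨x, hxS⟩) := by
    ext z
    rw [Finset.mem_Icc]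
    refine ⟨fun hz => ⟨hx.2 hz, S.le_max' z hz⟩, fun hz => ?_⟩
    simpa using ho.out hx.1 (S.max'_mem ⟨x, hxS⟩) hz
  have hxmax : x ≤ S.max' ⟨x, hxS⟩ := S.le_max' x hxS
  set M := S.max' ⟨x, hxS⟩
  rw [hS, Fin.card_Icc] at hc
  rw [hS, Finset.mem_Icc]
  simp only [Fin.le_def] at *
  omega

theorem restrict_dite {n m : ℕ} {S : Finset (Fin n)} (R : SubProfile S m) (Q : Profile n m) :
    Profile.restrict (fun i => if h : i ∈ S then R ⟨i, h⟩ else Q i) S = R := by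
  funext i
  simp [Profile.restrict]

/-- A profile of the group `q` and a chain of group counts extend to a profile of all voters. -/
theorem IsPartition.exists_profile_of_chain {n m g k : ℕ} [NeZero m] {N : Fin g → Finset (Fin n)}
    (hN : IsPartition N) {q : Fin g} {γ : Fin (k + 1) → Gam N} (hγ : Monotone γ) {x : Fin m}
    {p : Fin k → Fin m} (hp : ∀ t, (p t : ℕ) = x + t) (R : SubProfile (N q) m)
    (hR : ∀ j, countLE R (p j) = γ j.succ q)
    (hR0 : ∀ j : Fin k, (j : ℕ) = 0 → countLT R (p j) = γ 0 q) :
    ∃ P : Profile n m, P.restrict (N q) = R ∧ (∀ j, p j ≠ ⊤ → counts N P (p j) = γ j.succ) ∧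
      ∀ j, p j ≠ ⊥ → countsLT N P (p j) = γ j.castSucc := by
  obtain ⟨grp, rk, huniq, hrk⟩ := hN.exists_group_rank
  choose pref hpref using fun a : Fin m => Pref.exists_top_eq a
  -- A voter outside group `q` gets the first `p j` whose count exceeds the voter's rank; the lowest
  -- ranks go to `⊥`, and those never reached to `⊤`, the empty infimum.
  let T : Fin n → Fin m := fun i => if rk i < γ 0 (grp i) then ⊥ else
    (Finset.univ.filter fun j : Fin k => rk i < γ j.succ (grp i)).inf p
  set P : Profile n m := fun i => if h : i ∈ N q then R ⟨i, h⟩ else pref (T i) with hP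
  have hPR : P.restrict (N q) = R := restrict_dite R fun i => pref (T i)
  have key : ∀ (a : Fin m) (c : Gam N), countLE R a = c q →
      (∀ i, T i ≤ a ↔ rk i < c (grp i)) → counts N P a = c := by
    intro a c h1 h2
    funext q'
    apply Fin.ext
    change countLE _ a = _
    by_cases hq : q' = q
    · subst hq
      rw [hPR, h1]
    · rw [countLE_restrict, ← hrk q' (c q') (Nat.lt_succ_iff.1 (c q').2)]
      congr 1
      refine Finset.filter_congr fun i hi => ?_
      have hiq : i ∉ N q := Finset.disjoint_left.1 (hN.1 q' q hq) hi
      rw [hP]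
      simp only [hiq, dite_false, hpref]
      rw [h2, huniq q' i hi]
  have hγ' : ∀ s t, s ≤ t → ∀ q, (γ s q : ℕ) ≤ γ t q := fun s t h q => hγ h q
  have h1 : ∀ j, p j ≠ ⊤ → counts N P (p j) = γ j.succ := by
    intro j hj
    refine key _ _ (hR j) fun i => ?_
    simp only [T]
    split_ifs with h
    · simpa using h.trans_le (hγ' 0 j.succ (Fin.zero_le _) _)
    · rw [Finset.inf_le_iff (lt_top_iff_ne_top.2 hj)]
      simp only [Finset.mem_filter, Finset.mem_univ, true_and]
      refine ⟨?_, fun h' => ⟨j, h', le_rfl⟩⟩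
      rintro ⟨j', h2, h3⟩
      refine h2.trans_le (hγ' _ _ ?_ _)
      rw [Fin.succ_le_succ_iff]
      rw [Fin.le_def, hp, hp] at h3
      rw [Fin.le_def]
      omega
  refine ⟨P, hPR, h1, fun j hj => ?_⟩
  have hj0 : (p j : ℕ) ≠ 0 := fun h0 =>
    hj (le_bot_iff.1 (by rw [Fin.le_def, h0]; exact Nat.zero_le _))
  let a : Fin m := ⟨p j - 1, by omega⟩
  have ha : (p j : ℕ) = a + 1 := by simp only [a]; omega
  have hatop : a < ⊤ := lt_of_lt_of_le (Fin.lt_def.2 (by omega : (a : ℕ) < p j)) le_top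
  rw [countsLT_eq_counts N P ha]
  rcases Nat.eq_zero_or_pos (j : ℕ) with h0 | hpos
  · have hjz : j.castSucc = 0 := Fin.ext h0
    rw [hjz]
    refine key _ _ (by rw [← countLT_eq_countLE R ha, hR0 j h0]) fun i => ?_
    simp only [T]
    split_ifs with h
    · simpa using h
    · rw [Finset.inf_le_iff hatop]
      simp only [h, iff_false]
      rintro ⟨j', -, h3⟩
      rw [Fin.le_def, hp] at h3
      rw [hp] at ha
      omega
  · let j' : Fin k := ⟨j - 1, by omega⟩
    have hja : p j' = a := Fin.ext (by rw [hp]; rw [hp] at ha; simp only [j']; omega)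
    have hjs : j'.succ = j.castSucc :=
      Fin.ext (by simp only [j', Fin.val_succ, Fin.val_castSucc]; omega)
    rw [← hja, ← hjs]
    exact h1 j' (hja ▸ hatop.ne)

section Guarantee

variable {n m g r : ℕ} [NeZero m] {N : Fin g → Finset (Fin n)} {κ : Fin g → ℕ}
  {ψ : ∀ q, RepFun (N q) m} {η : Fin g → ℝ} {φ : RSCR n m}
  {lam : Fin r → ℝ} {f : Fin r → DSCR n m} {β : Fin r → Gam N → Fin m}

theorem IsGroupMinMaxMixture.strongCondition (h : IsGroupMinMaxMixture N φ lam f β)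
    (hN : IsPartition N) (hκ : ∀ q, 1 ≤ κ q) (hψ : Compliant N κ ψ)
    (hG : StrongGEG N ψ η φ) : StrongCondition N κ ψ η lam β := by
  rintro q γ hγ x p hp ⟨R, hR0, hR⟩
  obtain ⟨P, hPR, hle, hlt⟩ := hN.exists_profile_of_chain hγ hp R hR fun j hj => (hR0 j hj).2
  obtain ⟨a, ha, haη⟩ := hG P q
  rw [hPR] at ha
  let j₀ : Fin (κ q) := ⟨0, hκ q⟩
  have hj₀ : (p j₀ : ℕ) = x := by rw [hp]; simp [j₀]
  obtain ⟨h1, h2⟩ := (mem_iff_of_ordConnected ((hψ q).2 R).1 ((hψ q).2 R).2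
    (hR0 j₀ rfl).1 a).1 ha
  rw [Fin.le_def] at h1
  refine ⟨⟨a - x, by omega⟩, ?_⟩
  have hpa : p ⟨a - x, by omega⟩ = a := Fin.ext (by rw [hp]; simp only; omega)
  generalize (⟨a - x, by omega⟩ : Fin (κ q)) = t at hpa ⊢
  subst hpa
  rw [h.prob_eq] at haη
  refine haη.trans (le_of_eq ?_)
  congr 1
  ext w
  simp only [Finset.mem_filter, Finset.mem_univ, true_and]
  refine and_congr ?_ ?_
  -- At the extreme projects the counts may differ from the chain, but there the inequality on `β`
  -- is vacuous.
  · by_cases hb : p t = ⊥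
    · simp [hb]
    · rw [hlt t hb]
  · by_cases hb : p t = ⊤
    · simp [hb]
    · rw [hle t hb]

theorem IsGroupMinMaxMixture.strongGEG (h : IsGroupMinMaxMixture N φ lam f β)
    (hκ : ∀ q, 1 ≤ κ q) (hψ : Compliant N κ ψ) (hC : StrongCondition N κ ψ η lam β) :
    StrongGEG N ψ η φ := by
  intro P q
  set R := P.restrict (N q) with hR
  obtain ⟨hcard, hord⟩ := (hψ q).2 R
  have hne : (ψ q R).Nonempty := Finset.card_pos.1 (by rw [hcard]; exact hκ q)
  set x := (ψ q R).min' hne with hx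
  have hleast : IsLeast (ψ q R : Set (Fin m)) x := Finset.isLeast_min' _ hne
  have hmem := mem_iff_of_ordConnected hcard hord hleast
  have hxm : (x : ℕ) + κ q ≤ m := by
    have hsub : ψ q R ⊆ Finset.Ici x := fun y hy => Finset.mem_Ici.2 ((hmem y).1 hy).1
    have := Finset.card_le_card hsub
    rw [hcard, Fin.card_Ici] at this
    have := x.2
    omega
  let p : Fin (κ q) → Fin m := fun t => ⟨x + t, by omega⟩
  -- The chain of actual counts: consecutive projects share a count, since strictly before one means
  -- at or before its predecessor.
  let γ : Fin (κ q + 1) → Gam N := Fin.cons (countsLT N P x) fun j => counts N P (p j)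
  have hp0 : ∀ j : Fin (κ q), (j : ℕ) = 0 → p j = x := fun j hj => Fin.ext (by simp [p, hj])
  have hcast : ∀ t : Fin (κ q), γ t.castSucc = countsLT N P (p t) := by
    intro t
    rcases Nat.eq_zero_or_pos (t : ℕ) with h0 | hpos
    · have ht : t.castSucc = 0 := Fin.ext h0
      rw [ht, hp0 t h0]
      rfl
    · let t' : Fin (κ q) := ⟨t - 1, by omega⟩
      have ht : t.castSucc = t'.succ :=
        Fin.ext (by simp only [t', Fin.val_succ, Fin.val_castSucc]; omega)
      rw [ht, countsLT_eq_counts N P (p' := p t') (by simp only [p, t']; omega)]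
      rfl
  have hmono : Monotone γ := by
    refine Fin.monotone_iff_le_succ.2 fun t => ?_
    rw [hcast]
    exact fun q' => countLT_le_countLE _ _
  obtain ⟨t, ht⟩ := hC q γ hmono x p (fun _ => rfl) ⟨R, fun j hj => by
    rw [hp0 j hj]
    exact ⟨hleast, rfl⟩, fun j => rfl⟩
  refine ⟨p t, (hmem _).2 ⟨?_, ?_⟩, ?_⟩
  · simp [Fin.le_def, p]
  · simp [p]
  · rw [h.prob_eq]
    rw [hcast] at ht
    exact ht

end Guarantee

end GroupFair

open GroupFair
theorem mainTheorem7 (n m g : ℕ) [NeZero m] (hn : 2 ≤ n)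
    (N : Fin g → Finset (Fin n)) (hN : IsPartition N)
    (κ : Fin g → ℕ) (hκ : ∀ q, 1 ≤ κ q ∧ κ q ≤ m)
    (η : Fin g → ℝ) (hη : ∀ q, 0 ≤ η q ∧ η q ≤ 1)
    (ψ : ∀ q, RepFun (N q) m) (hψ : Compliant N κ ψ)
    (φ : RSCR n m) :
    (Unanimous φ ∧ StrategyProof φ ∧ GroupwiseAnonymous N φ ∧ StrongGEG N ψ η φ) ↔
      ∃ (r : ℕ) (lam : Fin r → ℝ) (f : Fin r → DSCR n m) (β : Fin r → Gam N → Fin m),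
        IsGroupMinMaxMixture N φ lam f β ∧ StrongCondition N κ ψ η lam β := by
  constructor
  · rintro ⟨hu, hs, ha, hG⟩
    obtain ⟨r, lam, f, β, h⟩ := exists_isGroupMinMaxMixture hN hu hs ha
    exact ⟨r, lam, f, β, h, h.strongCondition hN (fun q => (hκ q).1) hψ hG⟩
  · rintro ⟨r, lam, f, β, h, hC⟩
    exact ⟨h.unanimous, h.strategyProof, h.groupwiseAnonymous,
      h.strongGEG (fun q => (hκ q).1) hψ hC⟩
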